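/- For each $N\in\mathbb N$ let $V_N$ be a Morse function on a measurable configuration space $G_N\subset\mathbb R^N$: $V_N$ is smooth in a neighbourhood of every point of $G_N$, and its Hessian $\mathcal H_{V_N}(q)$ is nondegenerate at every stationary point $q\in G_N$ (every $q\in G_N$ with $\mathrm dV_N(q)=0$). Let $$\Omega_N(v)=\int_{G_N}\delta\bigl(V_N(q)-Nv\bigr)\,\mathrm dq,\qquad s_N(v)=\tfrac1N\ln\Omega_N(v)$$ be the configurational density of states and entropy, where the right-hand integral means $\limsup_{h\downarrow0}\frac1{2h}\,\mathrm{vol}\{q\in G_N:|V_N(q)-Nv|<h\}$. A stationary point $q$ of index $k(q)$ contributes to $\Omega_N$ the nonanalytic term $h_{N,k(q)}\bigl(v-V_N(q)/N\bigr)/\sqrt{|\det\mathcal H_{V_N}(q)|}$, where $$h_{N,k}(v)=\frac{(2\pi N)^{N/2}}{N\,\Gamma(N/2)}\begin{cases}(-1)^{k/2}\,v^{(N-2)/2}\,\Theta(v)&k\text{ even},\\(-1)^{(k+1)/2}\,v^{(N-2)/2}\,\pi^{-1}\ln|v|&N\text{ even, }k\text{ odd},\\(-1)^{(N-k)/2}\,(-v)^{(N-2)/2}\,\Theta(-v)&N,k\text{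 odd},\end{cases}$$ and $\Theta$ is the Heaviside function. For $\delta>0$ let $B_N^\delta(v)$ be the sum of these terms over all stationary points $q\in G_N$ with $|V_N(q)/N-v_{\mathrm t}|<\delta$, and let $s_N^\delta(v)=\frac1N\ln\bigl|\Omega_N(v)-B_N^\delta(v)\bigr|$ be the entropy with these nonanalytic contributions removed. Let $v_{\mathrm t}\in\mathbb R$ be such that the limit $s(v)=\lim_{N\to\infty}s_N(v)\in\mathbb R$ exists for all $v$ in a neighbourhood of $v_{\mathrm t}$. Suppose that for some $r>0$: 1. there is a constant $C$ such that, for all large $N$, the number of stationary points $q\in G_N$ of $V_N$ with $|V_N(q)/N-v_{\mathrm t}|<r$ is finite and at most $\exp(CN)$; 2. no sequence of such stationary points becomes asymptotically flat: for all $N_1<N_2<\cdots$ and all stationary points $q_j\in G_{N_j}$ of $V_{N_j}$ with $|V_{N_j}(q_j)/N_j-v_{\mathrm t}|<r$, there is $c>0$ with $|\det\mathcal H_{V_{N_j}}(q_j)|^{1/N_j}\ge c$ for all large $j$. Then the nonanalytic contributions of the stationary points cannot induce a phase transition (a nonanalyticity of the limiting entropy) at $v_{\mathrm t}$. That is, there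 is $\delta_0>0$ such that for every $\delta\in(0,\delta_0)$: * $s$ is real-analytic at $v_{\mathrm t}$ if and only if, in a neighbourhood of $v_{\mathrm t}$, the $s_N^\delta$ converge pointwise as $N\to\infty$ to a real-valued function that is real-analytic at $v_{\mathrm t}$; and * if $s$ is bounded below near $v_{\mathrm t}$ (for instance continuous at $v_{\mathrm t}$), then $\lim_{N\to\infty}s_N^\delta(v)=s(v)$ for all $v$ in a neighbourhood of $v_{\mathrm t}$. -/

import Mathlib

open Filter Topology MeasureTheory
open scoped ENNReal ContDiff

noncomputable section

namespace StationaryPoints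

/-- The space `ℝ^N` of the coordinates `q = (q_1, …, q_N)`, with Lebesgue measure `volume`. -/
abbrev Conf (N : ℕ) : Type := EuclideanSpace ℝ (Fin N)

/-- The Hessian matrix `∂²V / ∂q_i ∂q_j` at `q`. -/
def hessian {N : ℕ} (V : Conf N → ℝ) (q : Conf N) : Matrix (Fin N) (Fin N) ℝ :=
  Matrix.of fun i j =>
    fderiv ℝ (fderiv ℝ V) q (EuclideanSpace.single i 1) (EuclideanSpace.single j 1)

/-- The index of `V` at `q`: the maximal dimension of a subspace on which the Hessian form is
negative definite, i.e. the number of negative eigenvalues of the Hessian. -/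
def index {N : ℕ} (V : Conf N → ℝ) (q : Conf N) : ℕ :=
  sigNeg (hessian V q).toQuadraticForm'

/-- `V` is smooth near every point of the configuration space `G`, and its Hessian is
nondegenerate at every stationary point in `G`. -/
def IsMorseOn {N : ℕ} (V : Conf N → ℝ) (G : Set (Conf N)) : Prop :=
  (∀ q ∈ G, ContDiffAt ℝ ∞ V q) ∧ ∀ q ∈ G, fderiv ℝ V q = 0 → (hessian V q).det ≠ 0

/-- The stationary points of `V` in `G` whose potential energy per degree of freedom lies in
`(v - r, v + r)`. -/
def stationaryPoints {N : ℕ} (V : Conf N → ℝ) (G : Set (Conf N)) (v r : ℝ) : Set (Conf N) :=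
  {q | q ∈ G ∧ fderiv ℝ V q = 0 ∧ |V q / N - v| < r}

/-- The configurational density of states `Ω_N(v) = ∫_G δ(V(q) - N v) dq`, the Dirac delta being
the limit of the normalized indicator functions of `(-h, h)` as `h` decreases to `0`. -/
def densityOfStates {N : ℕ} (V : Conf N → ℝ) (G : Set (Conf N)) (v : ℝ) : ℝ≥0∞ :=
  limsup (fun h : ℝ => volume {q ∈ G | |V q - N * v| < h} / ENNReal.ofReal (2 * h)) (𝓝[>] 0)

/-- The configurational microcanonical entropy `s_N(v) = ln Ω_N(v) / N`; it is `-∞` where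
`Ω_N(v) = 0`. -/
def entropy {N : ℕ} (V : Conf N → ℝ) (G : Set (Conf N)) (v : ℝ) : EReal :=
  ENNReal.log (densityOfStates V G v) / (N : EReal)

/-- The function `h_{N,k}`: the nonanalytic term at `v = 0` of the configurational density of
states of a potential with a nondegenerate stationary point of index `k` at potential energy `0`,
up to the factor `|det Hess|^(-1/2)`. The constant in front is the one that belongs to
`Ω_N(v) = ∫ δ(V(q) - N v) dq` with Lebesgue measure `dq`. -/
def nonanalyticTerm (N k : ℕ) (v : ℝ) : ℝ :=
  (2 * Real.pi * N) ^ ((N : ℝ) / 2) / (N * Real.Gamma ((N : ℝ) / 2)) *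
    if Even k then (-1) ^ (k / 2) * (if 0 < v then v ^ (((N : ℝ) - 2) / 2) else 0)
    else if Even N then (-1) ^ ((k + 1) / 2) * v ^ (N / 2 - 1) * (Real.pi⁻¹ * Real.log |v|)
    else (-1) ^ ((N - k) / 2) * (if v < 0 then (-v) ^ (((N : ℝ) - 2) / 2) else 0)

/-- The total nonanalytic contribution to `Ω_N(v)` of the stationary points whose potential energy
per degree of freedom lies in `(v₀ - r, v₀ + r)`. -/
def nonanalyticContribution {N : ℕ} (V : Conf N → ℝ) (G : Set (Conf N)) (v₀ r v : ℝ) : ℝ :=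
  ∑ᶠ q ∈ stationaryPoints V G v₀ r,
    nonanalyticTerm N (index V q) (v - V q / N) / √|(hessian V q).det|

/-- The entropy after removal of these nonanalytic contributions from the density of states:
`ln |Ω_N(v) - B_N(v)| / N`. -/
def reducedEntropy {N : ℕ} (V : Conf N → ℝ) (G : Set (Conf N)) (v₀ r v : ℝ) : EReal :=
  ENNReal.log (EReal.abs ((densityOfStates V G v : EReal) -
    (nonanalyticContribution V G v₀ r v : EReal))) / (N : EReal)

/-- Near `v₀` the functions `F N` converge pointwise, as `N → ∞`, to a real-valued function that
is real-analytic at `v₀`: the thermodynamic limit of `F` has no phase transition at `v₀`. -/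
def HasAnalyticLimitAt (F : ℕ → ℝ → EReal) (v₀ : ℝ) : Prop :=
  ∃ f : ℝ → ℝ, AnalyticAt ℝ f v₀ ∧
    ∀ᶠ v in 𝓝 v₀, Tendsto (fun N => F N v) atTop (𝓝 (f v : EReal))

end StationaryPoints

end

/-!
The number of stationary points near `vt`, their Hessian determinants and the constant in front of
`h_{N,k}` are all controlled by exponentials in `N`, whereas the remaining factor of each
nonanalytic term is, up to a logarithm, the power `|v - V(q)/N| ^ (N/2 - 1)`. When both `v` and
`V(q)/N` are within `δ` of `vt`, that power is at most about `(2δ) ^ (N/2)`. Hence, for every `M`,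
the total contribution `B` of the stationary points is at most `exp (-M N)` once `δ` is small and
`N` is large, uniformly in `v` near `vt` (`exists_nonanalyticContribution_le`). The ingredients are
the elementary half of Stirling's formula (`rpow_self_mul_exp_neg_le_Gamma_add_one`) for the
constant, and a diagonal argument that turns the absence of asymptotically flat sequences into a
uniform lower bound on the determinants (`exists_pow_le_abs_det_hessian`).

A perturbation of size `exp (-M N)` does not change an exponential growth rate that exceeds `-M`
(`tendsto_log_div_of_le_add`). This is used in both directions: if `s v > -M`, then the reduced
entropies converge to `s v`; and if the reduced entropies converge to some `f v > -M`, then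
`f v = s v`. The threshold `M` is chosen with `-M < s vt`, and with `-M` below a lower bound of `s`
near `vt` if there is one, which settles the claim for `s` bounded below.

If `s` is analytic at `vt`, then `s > -M` near `vt` by continuity. Conversely, if the reduced
entropies have an analytic limit `f`, the first direction at `vt` itself gives `f vt = s vt > -M`,
so that `f > -M` near `vt` by continuity of `f`, and the second direction gives `f = s` there: the
value at the single point `vt` excludes that `s` drops below `-M` at points accumulating at `vt`.
-/

namespace StationaryPoints

/-! ### Exponential growth rates -/

/-- Two sequences that differ by at most `exp (-M N)` have the same exponential growth rate, as soon
as the rate of the first exceeds `-M`. -/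
theorem tendsto_log_div_of_le_add {x y : ℕ → ℝ≥0∞} {M s : ℝ}
    (hxy : ∀ᶠ N : ℕ in atTop, x N ≤ y N + ENNReal.ofReal (Real.exp (-M * N)))
    (hyx : ∀ᶠ N : ℕ in atTop, y N ≤ x N + ENNReal.ofReal (Real.exp (-M * N)))
    (hM : -M < s)
    (hx : Tendsto (fun N => ENNReal.log (x N) / (N : EReal)) atTop (𝓝 (s : EReal))) :
    Tendsto (fun N => ENNReal.log (y N) / (N : EReal)) atTop (𝓝 (s : EReal)) := by
  have log_exp (t : ℝ) (N : ℕ) :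
      ENNReal.log (ENNReal.ofReal (Real.exp (t * N))) = (t : EReal) * (N : EReal) := by
    rw [ENNReal.log_ofReal_of_pos (Real.exp_pos _), Real.log_exp]
    push_cast
    rfl
  have lt_log_div (t : ℝ) {N : ℕ} (hN : 0 < N) (z : ℝ≥0∞) :
      (t : EReal) < ENNReal.log z / N ↔ ENNReal.ofReal (Real.exp (t * N)) < z := by
    rw [EReal.lt_div_iff (by exact_mod_cast hN) (EReal.natCast_ne_top N), ← log_exp,
      ENNReal.log_lt_log_iff]
  have log_div_lt (t : ℝ) {N : ℕ} (hN : 0 < N) (z : ℝ≥0∞) :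
      ENNReal.log z / N < (t : EReal) ↔ z < ENNReal.ofReal (Real.exp (t * N)) := by
    rw [EReal.div_lt_iff (by exact_mod_cast hN) (EReal.natCast_ne_top N), ← log_exp,
      ENNReal.log_lt_log_iff]
  -- A sum of two exponentials is absorbed by any exponential with a larger rate.
  have add_le {a b t : ℝ} (ha : a < t) (hb : b < t) : ∀ᶠ N : ℕ in atTop,
      ENNReal.ofReal (Real.exp (a * N)) + ENNReal.ofReal (Real.exp (b * N))
        ≤ ENNReal.ofReal (Real.exp (t * N)) := by
    have small {a : ℝ} (ha : a < t) :
        ∀ᶠ N : ℕ in atTop, Real.exp (a * N) ≤ Real.exp (t * N) / 2 := by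
      have h : Tendsto (fun N : ℕ => (t - a) * (N : ℝ)) atTop atTop :=
        tendsto_natCast_atTop_atTop.const_mul_atTop (sub_pos.2 ha)
      filter_upwards [h.eventually_ge_atTop (Real.log 2)] with N hN
      rw [← Real.exp_log two_pos, ← Real.exp_sub, Real.exp_le_exp]
      linarith
    filter_upwards [small ha, small hb] with N h₁ h₂
    rw [← ENNReal.ofReal_add (Real.exp_pos _).le (Real.exp_pos _).le]
    exact ENNReal.ofReal_le_ofReal (by linarith)
  refine tendsto_order.2 ⟨fun a ha => ?_, fun b hb => ?_⟩
  · obtain ⟨a', haa', ha's⟩ := EReal.lt_iff_exists_real_btwn.1 ha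
    obtain ⟨t, ht, hts⟩ := exists_between (max_lt (EReal.coe_lt_coe_iff.1 ha's) hM)
    filter_upwards [hx.eventually_const_lt (EReal.coe_lt_coe_iff.2 hts), hxy, eventually_gt_atTop 0,
      add_le ((le_max_left _ _).trans_lt ht) ((le_max_right _ _).trans_lt ht)]
      with N h₁ h₂ h₃ h₄
    refine haa'.trans ((lt_log_div a' h₃ _).2 (lt_of_not_ge fun h => ?_))
    exact ((lt_log_div t h₃ _).1 h₁).not_ge (h₂.trans ((add_le_add_left h _).trans h₄))
  · obtain ⟨b', hsb', hbb'⟩ := EReal.lt_iff_exists_real_btwn.1 hb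
    obtain ⟨t, hst, htb⟩ := exists_between (EReal.coe_lt_coe_iff.1 hsb')
    filter_upwards [hx.eventually_lt_const (EReal.coe_lt_coe_iff.2 hst), hyx, eventually_gt_atTop 0,
      add_le htb ((hM.trans hst).trans htb)] with N h₁ h₂ h₃ h₄
    refine lt_trans ((log_div_lt b' h₃ _).2 (h₂.trans_lt ?_)) hbb'
    exact (ENNReal.add_lt_add_right ENNReal.ofReal_ne_top ((log_div_lt t h₃ _).1 h₁)).trans_le h₄

theorem abs_coe_sub_le_add (a : ℝ≥0∞) (b : ℝ) :
    EReal.abs ((a : EReal) - (b : EReal)) ≤ a + ENNReal.ofReal |b| := by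
  induction a with
  | top => simp
  | coe a =>
    rw [EReal.coe_nnreal_eq_coe_real, ← EReal.coe_sub, EReal.abs_def, ← ENNReal.ofReal_coe_nnreal,
      ← ENNReal.ofReal_add a.coe_nonneg (abs_nonneg b)]
    refine ENNReal.ofReal_le_ofReal ((abs_sub (a : ℝ) b).trans_eq ?_)
    rw [abs_of_nonneg a.coe_nonneg]

theorem le_abs_coe_sub_add (a : ℝ≥0∞) (b : ℝ) :
    a ≤ EReal.abs ((a : EReal) - (b : EReal)) + ENNReal.ofReal |b| := by
  induction a with
  | top => simp
  | coe a =>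
    rw [EReal.coe_nnreal_eq_coe_real, ← EReal.coe_sub, EReal.abs_def, ← ENNReal.ofReal_coe_nnreal,
      ← ENNReal.ofReal_add (abs_nonneg _) (abs_nonneg b)]
    refine ENNReal.ofReal_le_ofReal ?_
    linarith [le_abs_self ((a : ℝ) - b), le_abs_self b]

/-! ### Size of the nonanalytic terms -/

theorem rpow_self_mul_exp_neg_le_Gamma_add_one {y : ℝ} (hy : 0 ≤ y) :
    y ^ y * Real.exp (-y) ≤ Real.Gamma (y + 1) := by
  have hint : IntegrableOn (fun t : ℝ => Real.exp (-t) * t ^ y) (Set.Ioi 0) := by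
    simpa using Real.GammaIntegral_convergent (s := y + 1) (by linarith)
  have hsub : Set.Ioi y ⊆ Set.Ioi (0 : ℝ) := Set.Ioi_subset_Ioi hy
  calc y ^ y * Real.exp (-y) = ∫ t in Set.Ioi y, Real.exp (-t) * y ^ y := by
        rw [integral_mul_const, integral_exp_neg_Ioi, mul_comm]
    _ ≤ ∫ t in Set.Ioi y, Real.exp (-t) * t ^ y := by
        refine setIntegral_mono_on ((integrableOn_exp_neg_Ioi y).mul_const _)
          (hint.mono_set hsub) measurableSet_Ioi fun t ht => ?_
        gcongr
        exact ht.le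
    _ ≤ ∫ t in Set.Ioi 0, Real.exp (-t) * t ^ y := by
        refine setIntegral_mono_set hint ?_ hsub.eventuallyLE
        filter_upwards [ae_restrict_mem measurableSet_Ioi] with t ht
        have : (0 : ℝ) < t := ht
        positivity
    _ = Real.Gamma (y + 1) := by
        rw [Real.Gamma_eq_integral (by linarith)]
        simp

theorem nonanalyticTerm_prefactor_le {N : ℕ} (hN : 0 < N) :
    (2 * Real.pi * N) ^ ((N : ℝ) / 2) / (N * Real.Gamma ((N : ℝ) / 2))
      ≤ √(4 * Real.pi * Real.exp 1) ^ N := by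
  have hN' : (0 : ℝ) < N := by exact_mod_cast hN
  set y : ℝ := (N : ℝ) / 2 with hy
  have hy0 : 0 < y := by positivity
  have hG : (N : ℝ) * Real.Gamma y = 2 * Real.Gamma (y + 1) := by
    rw [Real.Gamma_add_one hy0.ne', hy]
    ring
  have hsq : √(4 * Real.pi * Real.exp 1) ^ N = (4 * Real.pi * Real.exp 1) ^ y := by
    rw [Real.sqrt_eq_rpow, ← Real.rpow_natCast, ← Real.rpow_mul (by positivity), hy]
    congr 1
    ring
  have hNy : 2 * Real.pi * N = 4 * Real.pi * y := by rw [hy]; ring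
  rw [hG, hsq, hNy, div_le_iff₀ (mul_pos two_pos (Real.Gamma_pos_of_pos (by positivity))),
    Real.mul_rpow (by positivity) hy0.le, Real.mul_rpow (by positivity) (Real.exp_pos _).le,
    Real.exp_one_rpow]
  have hle := rpow_self_mul_exp_neg_le_Gamma_add_one hy0.le
  have hG0 := (Real.Gamma_pos_of_pos (by positivity : 0 < y + 1)).le
  rw [Real.exp_neg, ← div_eq_mul_inv, div_le_iff₀ (Real.exp_pos _)] at hle
  calc (4 * Real.pi) ^ y * y ^ y ≤ (4 * Real.pi) ^ y * (Real.Gamma (y + 1) * Real.exp y) := by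
        gcongr
    _ ≤ (4 * Real.pi) ^ y * (2 * Real.Gamma (y + 1) * Real.exp y) := by
        gcongr
        linarith
    _ = _ := by ring

/-- With `|v| ≤ η ^ 4` it suffices to bound the dependence on `v` by `|v| ^ (N / 4) ≤ η ^ N`, rather
than by `|v| ^ (N / 2 - 1)`. The smaller exponent leaves room for the logarithm in the case of even
`N` and odd `k`, where one of the `N / 2 - 1` factors `|v|` is spent on `|v| * |log |v|| ≤ 1`. -/
theorem abs_nonanalyticTerm_le {N : ℕ} (hN : 8 ≤ N) (k : ℕ) {v η : ℝ} (hη0 : 0 ≤ η) (hη1 : η ≤ 1)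
    (hv : |v| ≤ η ^ 4) :
    |nonanalyticTerm N k v| ≤ √(4 * Real.pi * Real.exp 1) ^ N * η ^ N := by
  have hN' : (8 : ℝ) ≤ N := by exact_mod_cast hN
  have hv1 : |v| ≤ 1 := hv.trans (pow_le_one₀ hη0 hη1)
  have hpow {p : ℝ} (hp : (N : ℝ) / 4 ≤ p) : |v| ^ p ≤ η ^ N := by
    calc |v| ^ p ≤ |v| ^ ((N : ℝ) / 4) :=
          Real.rpow_le_rpow_of_exponent_ge' (abs_nonneg v) hv1 (by positivity) hp
      _ ≤ (η ^ 4) ^ ((N : ℝ) / 4) := Real.rpow_le_rpow (abs_nonneg v) hv (by positivity)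
      _ = η ^ N := by
          rw [← Real.rpow_natCast, ← Real.rpow_natCast, ← Real.rpow_mul hη0]
          congr 1
          push_cast
          ring
  have hG : 0 < Real.Gamma ((N : ℝ) / 2) := Real.Gamma_pos_of_pos (by positivity)
  rw [nonanalyticTerm, abs_mul, abs_of_nonneg (by positivity)]
  refine mul_le_mul (nonanalyticTerm_prefactor_le (by omega)) ?_ (abs_nonneg _) (by positivity)
  split_ifs with hk hv0 hNe hv0
  · rw [abs_mul, abs_neg_one_pow, one_mul, abs_of_nonneg (Real.rpow_nonneg hv0.le _)]
    simpa [abs_of_pos hv0] using hpow (p := ((N : ℝ) - 2) / 2) (by linarith)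
  · simpa using pow_nonneg hη0 N
  · obtain ⟨n, rfl⟩ := hNe
    obtain ⟨m, rfl⟩ : ∃ m, n = m + 2 := ⟨n - 2, by omega⟩
    have hlog : |v| * |Real.log (|v|)| ≤ 1 := by
      rcases (abs_nonneg v).eq_or_lt with h | h
      · simp [← h]
      · rw [mul_comm, ← abs_of_pos h, ← abs_mul, abs_of_pos h]
        exact (Real.abs_log_mul_self_lt _ h hv1).le
    have hpi : Real.pi⁻¹ ≤ 1 := inv_le_one_of_one_le₀ (by linarith [Real.pi_gt_three])
    have hm : |v| ^ m ≤ η ^ (m + 2 + (m + 2)) := by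
      rw [← Real.rpow_natCast |v| m]
      refine hpow ?_
      push_cast at hN' ⊢
      linarith
    rw [show (m + 2 + (m + 2)) / 2 - 1 = m + 1 by omega, abs_mul, abs_mul, abs_neg_one_pow, one_mul,
      abs_pow, abs_mul, abs_of_pos (inv_pos.2 Real.pi_pos)]
    calc |v| ^ (m + 1) * (Real.pi⁻¹ * |Real.log (|v|)|)
        = |v| ^ m * (Real.pi⁻¹ * (|v| * |Real.log (|v|)|)) := by ring
      _ ≤ |v| ^ m * (1 * 1) := by gcongr
      _ ≤ _ := by simpa using hm
  · rw [abs_mul, abs_neg_one_pow, one_mul, abs_of_nonneg (Real.rpow_nonneg (by linarith) _)]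
    simpa [abs_of_neg hv0] using hpow (p := ((N : ℝ) - 2) / 2) (by linarith)
  · simpa using pow_nonneg hη0 N

/-! ### Size of the total contribution -/

/-- If the determinants had no uniform exponential lower bound, a diagonal choice of stationary
points with `|det| ^ (1 / N) < 1 / (j + 1)` would form an asymptotically flat sequence. -/
theorem exists_pow_le_abs_det_hessian
    {G : ∀ N : ℕ, Set (Conf N)} {V : ∀ N : ℕ, Conf N → ℝ} {vt r : ℝ}
    (hflat : ∀ (n : ℕ → ℕ) (q : ∀ j : ℕ, Conf (n j)), StrictMono n →
      (∀ j, q j ∈ stationaryPoints (V (n j)) (G (n j)) vt r) →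
      ∃ c : ℝ, 0 < c ∧ ∀ᶠ j in atTop, c ≤ |(hessian (V (n j)) (q j)).det| ^ (1 / (n j : ℝ))) :
    ∃ c : ℝ, 0 < c ∧ ∀ᶠ N : ℕ in atTop, ∀ q ∈ stationaryPoints (V N) (G N) vt r,
      c ^ N ≤ |(hessian (V N) q).det| := by
  suffices h : ∃ c : ℝ, 0 < c ∧ ∀ᶠ N : ℕ in atTop, ∀ q ∈ stationaryPoints (V N) (G N) vt r,
      c ≤ |(hessian (V N) q).det| ^ (1 / (N : ℝ)) by
    obtain ⟨c, hc, h⟩ := h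
    refine ⟨c, hc, ?_⟩
    filter_upwards [h, eventually_gt_atTop 0] with N hN h0 q hq
    have := pow_le_pow_left₀ hc.le (hN q hq) N
    rwa [one_div, Real.rpow_inv_natCast_pow (abs_nonneg _) h0.ne'] at this
  by_contra! hcon
  have hfreq (j : ℕ) : ∃ᶠ N : ℕ in atTop, ∃ q ∈ stationaryPoints (V N) (G N) vt r,
      |(hessian (V N) q).det| ^ (1 / (N : ℝ)) < 1 / ((j : ℝ) + 1) :=
    hcon (1 / ((j : ℝ) + 1)) Nat.one_div_pos_of_nat
  obtain ⟨n, hn, hq⟩ := extraction_forall_of_frequently hfreq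
  choose q hqmem hqlt using hq
  obtain ⟨c, hc, hev⟩ := hflat n q hn hqmem
  obtain ⟨j, h₁, h₂⟩ :=
    (hev.and ((tendsto_one_div_add_atTop_nhds_zero_nat (𝕜 := ℝ)).eventually_lt_const hc)).exists
  exact (h₁.trans_lt ((hqlt j).trans h₂)).false

/-- The contribution of the stationary points within `δ` of `vt` decays at any prescribed
exponential rate, provided that `δ` is small enough. -/
theorem exists_nonanalyticContribution_le
    {G : ∀ N : ℕ, Set (Conf N)} {V : ∀ N : ℕ, Conf N → ℝ} {vt r : ℝ} (hr : 0 < r) {C : ℝ}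
    (hcount : ∀ᶠ N : ℕ in atTop, (stationaryPoints (V N) (G N) vt r).Finite ∧
      ((stationaryPoints (V N) (G N) vt r).ncard : ℝ) ≤ Real.exp (C * N))
    (hflat : ∀ (n : ℕ → ℕ) (q : ∀ j : ℕ, Conf (n j)), StrictMono n →
      (∀ j, q j ∈ stationaryPoints (V (n j)) (G (n j)) vt r) →
      ∃ c : ℝ, 0 < c ∧ ∀ᶠ j in atTop, c ≤ |(hessian (V (n j)) (q j)).det| ^ (1 / (n j : ℝ)))
    (M : ℝ) :
    ∃ δ₀ : ℝ, 0 < δ₀ ∧ ∀ δ : ℝ, δ < δ₀ → ∀ᶠ N : ℕ in atTop, ∀ v : ℝ, |v - vt| < δ →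
      |nonanalyticContribution (V N) (G N) vt δ v| ≤ Real.exp (-M * N) := by
  obtain ⟨c, hc, hdet⟩ := exists_pow_le_abs_det_hessian hflat
  set A : ℝ := √(4 * Real.pi * Real.exp 1) with hA
  have hA0 : 0 < A := by positivity
  -- `η ^ 4` bounds `|v - V q / N|`, and `D * η ≤ exp (-M)`, where `D ^ N` bounds all other factors.
  set D : ℝ := Real.exp C * (A / √c) with hD
  have hD0 : 0 < D := by positivity
  obtain ⟨η, hη0, hη⟩ := exists_between
    (lt_min one_pos (lt_min hr (div_pos (Real.exp_pos (-M)) hD0)))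
  obtain ⟨hη1, hηr, hηD⟩ : η < 1 ∧ η < r ∧ η < Real.exp (-M) / D := by
    simpa only [lt_min_iff] using hη
  have hη4 : η ^ 4 ≤ η := pow_le_of_le_one hη0.le hη1.le (by norm_num)
  refine ⟨η ^ 4 / 2, by positivity, fun δ hδ => ?_⟩
  filter_upwards [hdet, hcount, eventually_ge_atTop 8] with N hdetN hcountN hN v hv
  obtain ⟨hfin, hcard⟩ := hcountN
  have hsub : stationaryPoints (V N) (G N) vt δ ⊆ stationaryPoints (V N) (G N) vt r :=
    fun q hq => ⟨hq.1, hq.2.1, hq.2.2.trans (by linarith)⟩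
  have hfinδ := hfin.subset hsub
  have hterm : ∀ q ∈ stationaryPoints (V N) (G N) vt δ,
      |nonanalyticTerm N (index (V N) q) (v - V N q / N) / √(|(hessian (V N) q).det|)|
        ≤ A ^ N * η ^ N / √c ^ N := by
    intro q hq
    rw [abs_div, abs_of_nonneg (Real.sqrt_nonneg _)]
    have hdist : |v - V N q / N| ≤ η ^ 4 := by
      have h := abs_sub_le v vt (V N q / N)
      rw [abs_sub_comm vt] at h
      linarith [hq.2.2]
    have hsqrt : √c ^ N ≤ √|(hessian (V N) q).det| := by
      rw [Real.le_sqrt (by positivity) (abs_nonneg _), ← pow_mul, mul_comm, pow_mul,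
        Real.sq_sqrt hc.le]
      exact hdetN q (hsub hq)
    exact div_le_div₀ (by positivity) (abs_nonanalyticTerm_le hN _ hη0.le hη1.le hdist)
      (by positivity) hsqrt
  rw [nonanalyticContribution, finsum_mem_eq_finite_toFinset_sum _ hfinδ]
  calc _ ≤ ∑ q ∈ hfinδ.toFinset,
          |nonanalyticTerm N (index (V N) q) (v - V N q / N) / √(|(hessian (V N) q).det|)| :=
        Finset.abs_sum_le_sum_abs _ _
    _ ≤ hfinδ.toFinset.card • (A ^ N * η ^ N / √c ^ N) :=
        Finset.sum_le_card_nsmul _ _ _ fun q hq => hterm q (hfinδ.mem_toFinset.1 hq)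
    _ = (stationaryPoints (V N) (G N) vt δ).ncard * (A ^ N * η ^ N / √c ^ N) := by
        rw [nsmul_eq_mul, Set.ncard_eq_toFinset_card _ hfinδ]
    _ ≤ Real.exp (C * N) * (A ^ N * η ^ N / √c ^ N) := by
        gcongr
        exact le_trans (by exact_mod_cast Set.ncard_le_ncard hsub hfin) hcard
    _ = (η * D) ^ N := by
        rw [hD, mul_comm C, Real.exp_nat_mul]
        simp only [mul_pow, div_pow]
        ring
    _ ≤ Real.exp (-M) ^ N := by
        gcongr
        exact ((lt_div_iff₀ hD0).1 hηD).le
    _ = Real.exp (-M * N) := by rw [← Real.exp_nat_mul, mul_comm]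

/-! ### Comparison of the two entropies -/

theorem tendsto_reducedEntropy_of_entropy
    {G : ∀ N : ℕ, Set (Conf N)} {V : ∀ N : ℕ, Conf N → ℝ} {vt δ v M s : ℝ}
    (hB : ∀ᶠ N : ℕ in atTop,
      |nonanalyticContribution (V N) (G N) vt δ v| ≤ Real.exp (-M * N))
    (hM : -M < s)
    (h : Tendsto (fun N => entropy (V N) (G N) v) atTop (𝓝 (s : EReal))) :
    Tendsto (fun N => reducedEntropy (V N) (G N) vt δ v) atTop (𝓝 (s : EReal)) := by
  refine tendsto_log_div_of_le_add ?_ ?_ hM h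
  · filter_upwards [hB] with N hN
    exact (le_abs_coe_sub_add _ _).trans (by gcongr)
  · filter_upwards [hB] with N hN
    exact (abs_coe_sub_le_add _ _).trans (by gcongr)

theorem tendsto_entropy_of_reducedEntropy
    {G : ∀ N : ℕ, Set (Conf N)} {V : ∀ N : ℕ, Conf N → ℝ} {vt δ v M s : ℝ}
    (hB : ∀ᶠ N : ℕ in atTop,
      |nonanalyticContribution (V N) (G N) vt δ v| ≤ Real.exp (-M * N))
    (hM : -M < s)
    (h : Tendsto (fun N => reducedEntropy (V N) (G N) vt δ v) atTop (𝓝 (s : EReal))) :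
    Tendsto (fun N => entropy (V N) (G N) v) atTop (𝓝 (s : EReal)) := by
  refine tendsto_log_div_of_le_add ?_ ?_ hM h
  · filter_upwards [hB] with N hN
    exact (abs_coe_sub_le_add _ _).trans (by gcongr)
  · filter_upwards [hB] with N hN
    exact (le_abs_coe_sub_add _ _).trans (by gcongr)

end StationaryPoints

theorem mainTheorem2
    (G : ∀ N : ℕ, Set (StationaryPoints.Conf N)) (V : ∀ N : ℕ, StationaryPoints.Conf N → ℝ)
    (hG : ∀ N, MeasurableSet (G N))
    (hV : ∀ N, StationaryPoints.IsMorseOn (V N) (G N))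
    (s : ℝ → ℝ) (vt : ℝ)
    (hs : ∀ᶠ v in 𝓝 vt,
      Tendsto (fun N => StationaryPoints.entropy (V N) (G N) v) atTop (𝓝 (s v : EReal)))
    (r : ℝ) (hr : 0 < r)
    (C : ℝ)
    (hcount : ∀ᶠ N : ℕ in atTop,
      (StationaryPoints.stationaryPoints (V N) (G N) vt r).Finite ∧
      ((StationaryPoints.stationaryPoints (V N) (G N) vt r).ncard : ℝ) ≤ Real.exp (C * N))
    (hflat : ∀ (n : ℕ → ℕ) (q : ∀ j : ℕ, StationaryPoints.Conf (n j)), StrictMono n →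
      (∀ j, q j ∈ StationaryPoints.stationaryPoints (V (n j)) (G (n j)) vt r) →
      ∃ c : ℝ, 0 < c ∧ ∀ᶠ j in atTop,
        c ≤ |(StationaryPoints.hessian (V (n j)) (q j)).det| ^ (1 / (n j : ℝ))) :
    ∃ δ₀ : ℝ, 0 < δ₀ ∧ ∀ δ : ℝ, 0 < δ → δ < δ₀ →
      (AnalyticAt ℝ s vt ↔
        StationaryPoints.HasAnalyticLimitAt
          (fun N => StationaryPoints.reducedEntropy (V N) (G N) vt δ) vt) ∧
      ((∃ m : ℝ, ∀ᶠ v in 𝓝 vt, m ≤ s v) →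
        ∀ᶠ v in 𝓝 vt, Tendsto
          (fun N => StationaryPoints.reducedEntropy (V N) (G N) vt δ v) atTop
          (𝓝 (s v : EReal))) := by
  -- The second claim concerns at most one lower bound `m` of `s`, which may be fixed in advance.
  obtain ⟨m, hm⟩ : ∃ m : ℝ, (∃ m' : ℝ, ∀ᶠ v in 𝓝 vt, m' ≤ s v) → ∀ᶠ v in 𝓝 vt, m ≤ s v := by
    by_cases h : ∃ m' : ℝ, ∀ᶠ v in 𝓝 vt, m' ≤ s v
    · exact ⟨h.choose, fun _ => h.choose_spec⟩
    · exact ⟨0, fun h' => absurd h' h⟩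
  obtain ⟨M, hM⟩ := exists_gt (max (-s vt) (-m))
  obtain ⟨hMs, hMm⟩ := max_lt_iff.1 hM
  obtain ⟨δ₀, hδ₀, hB⟩ := StationaryPoints.exists_nonanalyticContribution_le hr hcount hflat M
  refine ⟨δ₀, hδ₀, fun δ hδ hδδ₀ => ?_⟩
  have hBv : ∀ᶠ v in 𝓝 vt, ∀ᶠ N : ℕ in atTop,
      |StationaryPoints.nonanalyticContribution (V N) (G N) vt δ v| ≤ Real.exp (-M * N) := by
    filter_upwards [Metric.ball_mem_nhds vt hδ] with v hv
    filter_upwards [hB δ hδδ₀] with N hN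
    exact hN v (by simpa [Real.dist_eq] using hv)
  have hreduced (hlow : ∀ᶠ v in 𝓝 vt, -M < s v) : ∀ᶠ v in 𝓝 vt,
      Tendsto (fun N => StationaryPoints.reducedEntropy (V N) (G N) vt δ v) atTop
        (𝓝 (s v : EReal)) := by
    filter_upwards [hlow, hBv, hs] with v h₁ h₂ h₃
    exact StationaryPoints.tendsto_reducedEntropy_of_entropy h₂ h₁ h₃
  refine ⟨⟨fun hana => ⟨s, hana, hreduced ?_⟩, ?_⟩, fun hbdd => hreduced ?_⟩
  · exact hana.continuousAt.eventually_const_lt (by linarith)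
  · rintro ⟨f, hf, hlim⟩
    have hfs : s vt = f vt := EReal.coe_injective <| tendsto_nhds_unique
      (StationaryPoints.tendsto_reducedEntropy_of_entropy hBv.self_of_nhds (by linarith)
        hs.self_of_nhds)
      hlim.self_of_nhds
    refine hf.congr ?_
    filter_upwards [hf.continuousAt.eventually_const_lt (show -M < f vt by linarith), hBv, hs, hlim]
      with v h₁ h₂ h₃ h₄
    exact EReal.coe_injective <|
      tendsto_nhds_unique (StationaryPoints.tendsto_entropy_of_reducedEntropy h₂ h₁ h₄) h₃
  · filter_upwards [hm hbdd] with v hv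
    linarith
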